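/- Let $\Bbbk$ be a field of characteristic $0$, let $d\ge 1$ and $n_1,\dots,n_d\ge 1$, let $\mathbf r=(r_1,\dots,r_m)$ with all $r_k\ge 2$, and put $R=r_1\cdots r_m$. Let $\odot$ denote the entrywise (Hadamard) product on $\Bbbk^{n_1\times\cdots\times n_d}$, with unit the all-ones tensor $\mathbb 1$. A rank-$1$ tensor is a nonzero tensor of the form $\mathbf a_1\otimes\cdots\otimes\mathbf a_d$, $\mathcal S$ denotes the Segre variety of all tensors $\mathbf a_1\otimes\cdots\otimes\mathbf a_d$ (so $0$ is included), and the rank of a tensor is the least number of rank-$1$ tensors of which it is the sum. A tensor $\mathcal T$ is *$R$-identifiable* if it has rank $R$ and there is exactly one multiset of $R$ rank-$1$ tensors with sum $\mathcal T$. An *$\mathbf r$-Hadamard–Hitchcock decomposition* ($\mathbf r$-HHD) of $\mathcal T$ is an expression $$\mathcal T=\Big(\sum_{i=1}^{r_1}\mathcal A_{1i}\Big)\odot\cdots\odot\Big(\sum_{i=1}^{r_m}\mathcal A_{mi}\Big)$$ with all $\mathcal A_{ki}$ of rank $1$. The tensor $\mathcal T$ is *$\mathbf r$-identifiable* if it has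 an $\mathbf r$-HHD and this is unique up to (i) permuting the summands within each Hadamard factor, (ii) permuting Hadamard factors of equal length, and (iii) replacing $\mathcal A_{ki}$ by $\mathcal D_k\odot\mathcal A_{ki}$ for all $k,i$, where $\mathcal D_1,\dots,\mathcal D_m$ are rank-$1$ tensors without zero entries and $\mathcal D_1\odot\cdots\odot\mathcal D_m=\mathbb 1$. Let $\sigma_{\mathbf r}(\mathcal S)\subset\Bbbk^{n_1\times\cdots\times n_d}$ be the Zariski closure of the set of all products $\mathcal T_1\odot\cdots\odot\mathcal T_m$ with $\operatorname{rank}\mathcal T_k\le r_k$. A property holds for a *generic* point of a variety $V$ if it holds on $V\setminus Z$ for some Zariski closed subset $Z\subsetneq V$. **Theorem.** (a) Let $(\mathcal A_{ki})_{k\in[m],\,i\in[r_k]}$ be a generic point of $\mathcal S^{r_1}\times\cdots\times\mathcal S^{r_m}$, and let $\mathcal T=\big(\sum_{i}\mathcal A_{1i}\big)\odot\cdots\odot\big(\sum_{i}\mathcal A_{mi}\big)$. If $\mathcal T$ is $R$-identifiable, then $\mathcal T$ is $\mathbf r$-identifiable. (b) If $\Bbbk$ is algebraically closed, then for generic $\mathcal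 T\in\sigma_{\mathbf r}(\mathcal S)$: if $\mathcal T$ is $R$-identifiable, then $\mathcal T$ is $\mathbf r$-identifiable. -/

import Mathlib

namespace HHD

/-- Multi-indices `[n_1] × ⋯ × [n_d]`. -/
abbrev Idx {d : ℕ} (n : Fin d → ℕ) : Type := (l : Fin d) → Fin (n l)

/-- Tensors of shape `n_1 × ⋯ × n_d` in coordinates. The pointwise ring structure makes `*` the
Hadamard product and `1` the all-ones tensor. -/
abbrev Tensor (k : Type*) {d : ℕ} (n : Fin d → ℕ) : Type _ := Idx n → k

section Zariski

variable {k : Type*} [Field k] {ι : Type*}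

/-- A subset of `k^ι` is Zariski closed if it is the zero locus of an ideal of polynomials. -/
def IsZariskiClosed (Z : Set (ι → k)) : Prop :=
  ∃ I : Ideal (MvPolynomial ι k), Z = MvPolynomial.zeroLocus k I

/-- The Zariski closure in `k^ι`. -/
def zariskiClosure (V : Set (ι → k)) : Set (ι → k) :=
  MvPolynomial.zeroLocus k (MvPolynomial.vanishingIdeal k V)

/-- `P` holds for a generic point of `V`: everywhere on `V` outside some strict Zariski closed
subset `Z ⊊ V`. -/
def Generically (V : Set (ι → k)) (P : (ι → k) → Prop) : Prop :=
  ∃ Z : Set (ι → k), IsZariskiClosed Z ∧ Z ⊂ V ∧ ∀ x ∈ V \ Z, P x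

end Zariski

section Tensors

variable {k : Type*} [Field k] {d : ℕ} {n : Fin d → ℕ}

/-- The tensor product `a_1 ⊗ ⋯ ⊗ a_d`. -/
def outer (a : (l : Fin d) → Fin (n l) → k) : Tensor k n := fun j => ∏ l, a l (j l)

variable (k n) in
/-- The (affine) Segre variety: rank-one tensors together with `0`. -/
def segre : Set (Tensor k n) := Set.range outer

/-- Rank-one tensors. -/
def IsRankOne (A : Tensor k n) : Prop := A ∈ segre k n ∧ A ≠ 0

/-- Rank-one tensors without zero entries. -/
def IsNowhereZeroRankOne (D : Tensor k n) : Prop := IsRankOne D ∧ ∀ j, D j ≠ 0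

/-- The unordered decompositions of `T` as a sum of `r` rank-one tensors. -/
def cpds (r : ℕ) (T : Tensor k n) : Set (Multiset (Tensor k n)) :=
  {s | s.card = r ∧ (∀ A ∈ s, IsRankOne A) ∧ s.sum = T}

/-- The tensor rank: the least length of a decomposition into rank-one tensors. -/
noncomputable def tensorRank (T : Tensor k n) : ℕ := sInf {r | (cpds r T).Nonempty}

/-- `r`-identifiability: `T` has rank `r` and exactly one rank-`r` decomposition, up to order. -/
def IsIdentifiable (r : ℕ) (T : Tensor k n) : Prop :=
  tensorRank T = r ∧ ∃ s, cpds r T = {s}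

variable {m : ℕ}

variable (k n) in
/-- Hadamard products `T_1 * ⋯ * T_m` with `rank T_i ≤ r_i`. -/
def openHadamardSecant (r : Fin m → ℕ) : Set (Tensor k n) :=
  {T | ∃ X : Fin m → Tensor k n, (∀ i, tensorRank (X i) ≤ r i) ∧ T = ∏ i, X i}

variable (k n) in
/-- The Hadamard product of secant varieties `σ_r(S)`. -/
def hadamardSecant (r : Fin m → ℕ) : Set (Tensor k n) :=
  zariskiClosure (openHadamardSecant k n r)

/-- The `r`-HHDs of `T`: the `i`-th Hadamard factor is an unordered `r_i`-tuple of rank-one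
tensors. The order of the Hadamard factors is divided out in `essentialClass`. -/
def hhds (r : Fin m → ℕ) (T : Tensor k n) : Set (Fin m → Multiset (Tensor k n)) :=
  {H | (∀ i, (H i).card = r i ∧ ∀ A ∈ H i, IsRankOne A) ∧ T = ∏ i, (H i).sum}

/-- The class of an `r`-HHD `H` of `T`: all `r`-HHDs of `T` obtained from `H` by permuting
Hadamard factors of equal length and Hadamard multiplying the `i`-th factor by `D_i`, where the
`D_i` are nowhere zero rank-one tensors with `D_1 * ⋯ * D_m = 1`. -/
def essentialClass (r : Fin m → ℕ) (T : Tensor k n) (H : Fin m → Multiset (Tensor k n)) :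
    Set (Fin m → Multiset (Tensor k n)) :=
  {H' ∈ hhds r T | ∃ (ψ : Equiv.Perm (Fin m)) (D : Fin m → Tensor k n),
    (∀ i, r (ψ i) = r i) ∧ (∀ i, IsNowhereZeroRankOne (D i)) ∧ ∏ i, D i = 1 ∧
    ∀ i, H' (ψ i) = (H i).map (fun A => D i * A)}

/-- The set of essential `r`-HHDs of `T`. -/
def essentialHHDs (r : Fin m → ℕ) (T : Tensor k n) :
    Set (Set (Fin m → Multiset (Tensor k n))) :=
  essentialClass r T '' hhds r T

/-- `r`-identifiability for a rank vector `r`: there is exactly one essential `r`-HHD. -/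
def IsHHDIdentifiable (r : Fin m → ℕ) (T : Tensor k n) : Prop :=
  ∃ c, essentialHHDs r T = {c}

/-- Coordinates of ordered `r`-HHDs: the entry `j` of the `p.2`-th summand of the `p.1`-th
Hadamard factor has coordinate `(p, j)`. -/
abbrev OrderedIdx {d m : ℕ} (n : Fin d → ℕ) (r : Fin m → ℕ) : Type :=
  ((i : Fin m) × Fin (r i)) × Idx n

variable (k n) in
/-- The variety `S^{r_1} × ⋯ × S^{r_m}` of ordered `r`-HHDs, in the affine space of all tuples of
tensors. -/
def orderedHHDs (r : Fin m → ℕ) : Set (OrderedIdx n r → k) :=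
  {x | ∀ p, (fun j => x (p, j)) ∈ segre k n}

/-- The tensor `(∑_j A_{1j}) * ⋯ * (∑_j A_{mj})` of an ordered `r`-HHD. -/
def hhdTensor (r : Fin m → ℕ) (x : OrderedIdx n r → k) : Tensor k n :=
  ∏ i, ∑ t : Fin (r i), fun j => x (⟨i, t⟩, j)

end Tensors

end HHD

/-!
Expanding the Hadamard product of sums writes `T` as the sum of the `R` rank-one tensors
`A_p = A_{1 p_1} * ⋯ * A_{m p_m}`, indexed by the grid `[r_1] × ⋯ × [r_m]`. If `T` is
`R`-identifiable, any other HHD of `T` yields the same `R` tensors, hence a permutation `φ` of the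
grid. The products `A_p A_q` do not change when `p` and `q` exchange a coordinate, and for generic
`A_{ki}` there are no further coincidences among them. So `φ` is compatible with exchanging
coordinates, which forces it to permute the axes and to act on each axis separately. Comparing the
factors of the two families of products then shows that they differ by scaling.

For part (b) the genericity has to be transported along `(A_{ki}) ↦ T`: by Chevalley's theorem the
image of a nonempty open set contains a nonempty open subset of the closure of the image.
-/

namespace HHD

section Grid

open Function

variable {ι : Type*} {X Y : ι → Type*} {Z : Type*}

theorem dependsOn_empty_of_forall_update_eq [DecidableEq ι] [Finite ι] {g : (∀ l, X l) → Z}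
    (hg : ∀ p l x, g (update p l x) = g p) : DependsOn g ∅ := by
  cases nonempty_fintype ι
  intro p q _
  have apply_piecewise : ∀ s : Finset ι, g (s.piecewise q p) = g p := by
    intro s
    induction s using Finset.induction_on with
    | empty => rw [Finset.piecewise_empty]
    | insert a s _ ih => rw [Finset.piecewise_insert, hg, ih]
  simpa only [Finset.piecewise_univ] using (apply_piecewise Finset.univ).symm

/-- The unordered pair of values of `g` at two points of a grid does not change when the two points
exchange a coordinate. -/
def IsSwapInvariant [DecidableEq ι] (g : (∀ l, X l) → Z) : Prop :=
  ∀ p q l, s(g (update p l (q l)), g (update q l (p l))) = s(g p, g q)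

theorem IsSwapInvariant.apply_eq_of_update_ne [DecidableEq ι] {g : (∀ l, X l) → Z}
    (hg : IsSwapInvariant g) {p q : ∀ l, X l} {l : ι} {x : X l} (h : g (update p l x) ≠ g p)
    (hq : q l = p l) : g q = g p := by
  have hswap := hg q (update p l x) l
  simp only [update_self, hq, update_idem, update_eq_self, Sym2.eq_iff] at hswap
  obtain ⟨-, hp⟩ | ⟨-, hp⟩ := hswap
  · exact absurd hp.symm h
  · exact hp.symm

theorem IsSwapInvariant.exists_dependsOn [DecidableEq ι] [Finite ι] [Nonempty ι]
    {g : (∀ l, X l) → Z} (hg : IsSwapInvariant g) : ∃ l, DependsOn g {l} := by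
  by_cases hconst : ∀ p l x, g (update p l x) = g p
  · exact ⟨Classical.arbitrary ι,
      (dependsOn_empty_of_forall_update_eq hconst).mono (Set.empty_subset _)⟩
  push Not at hconst
  obtain ⟨p, l, x, hx⟩ := hconst
  have eq_on_slice : ∀ q, q l = p l → g q = g p := fun q => hg.apply_eq_of_update_ne hx
  have eq_of_ne : ∀ q q', q' l = q l → g q ≠ g p → g q' = g q := fun q q' hq' hq =>
    hg.apply_eq_of_update_ne (x := p l) (by rwa [eq_on_slice _ (update_self ..), ne_comm]) hq'
  refine ⟨l, fun q q' hqq' => ?_⟩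
  replace hqq' : q l = q' l := hqq' l rfl
  by_cases hq : g q = g p
  · by_cases hq' : g q' = g p
    · rw [hq, hq']
    · exact eq_of_ne q' q hqq' hq'
  · exact (eq_of_ne q q' hqq'.symm hq).symm

theorem surjective_of_forall_dependsOn [∀ l, Nontrivial (X l)] {φ : (∀ l, X l) → ∀ i, Y i}
    (hφ : Injective φ) {τ : ι → ι} (hτ : ∀ i, DependsOn (fun p => φ p i) {τ i}) :
    Surjective τ := by
  classical
  intro l
  by_contra! hl
  let o : ∀ l, X l := fun l => Classical.arbitrary _
  obtain ⟨x, hx⟩ := exists_ne (o l)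
  have update_eq : update o l x = o := hφ <| funext fun i => hτ i fun _ hi => by
    rw [Set.mem_singleton_iff.1 hi, update_of_ne (hl i)]
  exact hx (by rw [← update_eq, update_self])

theorem exists_axes_equiv_of_forall_dependsOn [∀ l, Nonempty (X l)] (φ : (∀ l, X l) ≃ ∀ i, Y i)
    (τ : Equiv.Perm ι) (hτ : ∀ i, DependsOn (fun p => φ p i) {τ i}) :
    ∃ g : ∀ i, X (τ i) ≃ Y i, ∀ p i, φ p i = g i (p (τ i)) := by
  classical
  let o : ∀ l, X l := fun l => Classical.arbitrary _
  let g : ∀ i, X (τ i) → Y i := fun i x => φ (update o (τ i) x) i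
  have apply_eq : ∀ p i, φ p i = g i (p (τ i)) := fun p i => hτ i fun _ hi => by
    rw [Set.mem_singleton_iff.1 hi, update_self]
  have injective : ∀ i, Injective (g i) := fun i x y hxy => by
    have update_eq : update o (τ i) x = update o (τ i) y := φ.injective <| funext fun j => by
      obtain rfl | hj := eq_or_ne j i
      · exact hxy
      · simp only [apply_eq, update_of_ne (τ.injective.ne hj)]
    simpa only [update_self] using congrFun update_eq (τ i)
  have surjective : ∀ i, Surjective (g i) := fun i y =>
    ⟨φ.symm (update (φ o) i y) (τ i), by rw [← apply_eq, φ.apply_symm_apply, update_self]⟩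
  exact ⟨fun i => Equiv.ofBijective (g i) ⟨injective i, surjective i⟩, apply_eq⟩

theorem exists_axes_perm_of_isSwapInvariant [DecidableEq ι] [Finite ι] [∀ l, Nontrivial (X l)]
    (φ : (∀ l, X l) ≃ ∀ i, Y i) (hφ : ∀ i, IsSwapInvariant fun p => φ p i) :
    ∃ (τ : Equiv.Perm ι) (g : ∀ i, X (τ i) ≃ Y i), ∀ p i, φ p i = g i (p (τ i)) := by
  have exists_axis : ∀ i, ∃ l, DependsOn (fun p => φ p i) {l} := fun i =>
    have : Nonempty ι := ⟨i⟩
    (hφ i).exists_dependsOn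
  choose τ hτ using exists_axis
  have bijective : Bijective τ :=
    Finite.surjective_iff_bijective.1 (surjective_of_forall_dependsOn φ.injective hτ)
  exact ⟨Equiv.ofBijective τ bijective, exists_axes_equiv_of_forall_dependsOn φ _ hτ⟩

end Grid

section GridProducts

open Function

variable {ι : Type*} [Fintype ι] {X Y : ι → Type*} {M N : Type*}

theorem prod_update_mul_prod_update [DecidableEq ι] [CommMonoid M] (A : ∀ i, X i → M)
    (p q : ∀ i, X i) (l : ι) :
    (∏ i, A i (update p l (q l) i)) * ∏ i, A i (update q l (p l) i) =
      (∏ i, A i (p i)) * ∏ i, A i (q i) := by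
  simp only [← Finset.prod_mul_distrib]
  refine Finset.prod_congr rfl fun i _ => ?_
  obtain rfl | hi := eq_or_ne i l
  · simp only [update_self, mul_comm]
  · simp only [update_of_ne hi]

theorem prod_update_mul [DecidableEq ι] [CommMonoid M] (A : ∀ i, X i → M) (p : ∀ i, X i) (l : ι)
    (x : X l) : (∏ i, A i (update p l x i)) * A l (p l) = A l x * ∏ i, A i (p i) := by
  rw [← Finset.mul_prod_erase _ _ (Finset.mem_univ l),
    ← Finset.mul_prod_erase _ (fun i => A i (p i)) (Finset.mem_univ l), update_self, mul_right_comm,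
    mul_assoc]
  congr 2
  exact Finset.prod_congr rfl fun i hi => by rw [update_of_ne (Finset.ne_of_mem_erase hi)]

theorem mul_apply_eq_of_prod_eq [CommMonoid M] {A B : ∀ i, X i → M}
    (h : ∀ p : ∀ i, X i, ∏ i, B i (p i) = ∏ i, A i (p i)) {p : ∀ i, X i}
    (hp : IsUnit (∏ i, A i (p i))) (l : ι) (x : X l) :
    B l x * A l (p l) = B l (p l) * A l x := by
  classical
  have hA := prod_update_mul A p l x
  have hB := prod_update_mul B p l x
  rw [h, h] at hB
  apply hp.mul_right_cancel
  calc B l x * A l (p l) * ∏ i, A i (p i)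
      = (B l x * ∏ i, A i (p i)) * A l (p l) := mul_right_comm ..
    _ = B l (p l) * ((∏ i, A i (update p l x i)) * A l (p l)) := by rw [← hB]; ac_rfl
    _ = B l (p l) * A l x * ∏ i, A i (p i) := by rw [hA, mul_assoc]

theorem eq_div_mul_of_prod_eq [DivisionCommMonoid M] {A B : ∀ i, X i → M}
    (hA : ∀ i x, IsUnit (A i x)) (h : ∀ p : ∀ i, X i, ∏ i, B i (p i) = ∏ i, A i (p i))
    (p : ∀ i, X i) (l : ι) (x : X l) : B l x = B l (p l) / A l (p l) * A l x := by
  have hp : IsUnit (∏ i, A i (p i)) := IsUnit.prod_univ_iff.2 fun i => hA i _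
  rw [div_mul_eq_mul_div, (hA l _).eq_div_iff, mul_apply_eq_of_prod_eq h hp]

theorem isUnit_apply_of_forall_isUnit_prod [CommMonoid M] [∀ i, Nonempty (X i)] {A : ∀ i, X i → M}
    (hA : ∀ p : ∀ i, X i, IsUnit (∏ i, A i (p i))) (i : ι) (x : X i) : IsUnit (A i x) := by
  classical
  let o : ∀ i, X i := fun i => Classical.arbitrary _
  simpa only [update_self] using IsUnit.prod_univ_iff.1 (hA (update o i x)) i

/-- The products `∏ i, A i (p i)` over the points `p` of a grid satisfy no relations of the form
`A_p A_q = A_p' A_q'` besides those where `p'`, `q'` arise from `p`, `q` by exchanging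
coordinates. -/
def IsRelationFree [CommMonoid M] (A : ∀ i, X i → M) : Prop :=
  ∀ p q p' q' : ∀ i, X i,
    (∏ i, A i (p i)) * ∏ i, A i (q i) = (∏ i, A i (p' i)) * ∏ i, A i (q' i) →
      ∀ i, s(p i, q i) = s(p' i, q' i)

theorem IsRelationFree.of_map [CommMonoid M] [CommMonoid N] {A : ∀ i, X i → M} (f : M →* N)
    (h : IsRelationFree fun i x => f (A i x)) : IsRelationFree A := fun p q p' q' hA =>
  h p q p' q' (by simpa only [map_mul, map_prod] using congrArg f hA)

theorem IsRelationFree.exists_axes_perm [∀ i, Nontrivial (X i)] [CommMonoid M]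
    {A : ∀ i, Y i → M} {B : ∀ i, X i → M} (hA : IsRelationFree A) (φ : (∀ i, X i) ≃ ∀ i, Y i)
    (hφ : ∀ p, ∏ i, B i (p i) = ∏ i, A i (φ p i)) :
    ∃ (τ : Equiv.Perm ι) (g : ∀ i, X (τ i) ≃ Y i),
      ∀ p : ∀ i, X (τ i), ∏ i, B (τ i) (p i) = ∏ i, A i (g i (p i)) := by
  classical
  obtain ⟨τ, g, hg⟩ := exists_axes_perm_of_isSwapInvariant φ fun i p q l =>
    hA _ _ _ _ (by simp only [← hφ, prod_update_mul_prod_update]) i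
  refine ⟨τ, g, fun p => ?_⟩
  have hp := hφ (Equiv.piCongrLeft X τ p)
  rw [← Equiv.prod_comp τ] at hp
  simpa only [hg, Equiv.piCongrLeft_apply_apply] using hp

end GridProducts

section Segre

open Function

variable {k : Type*} [Field k] {d : ℕ} {n : Fin d → ℕ}

theorem outer_one : outer 1 = (1 : Tensor k n) :=
  funext fun _ => Finset.prod_const_one

theorem outer_mul (a b : (l : Fin d) → Fin (n l) → k) : outer (a * b) = outer a * outer b :=
  funext fun _ => Finset.prod_mul_distrib

theorem outer_inv (a : (l : Fin d) → Fin (n l) → k) : outer a⁻¹ = (outer a)⁻¹ :=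
  funext fun _ => Finset.prod_inv_distrib _

theorem outer_single_one (j : Idx n) :
    outer (n := n) (fun l => Pi.single (j l) 1) = (Pi.single j 1 : Tensor k n) := by
  funext j'
  simp only [outer, Pi.single_apply, Finset.prod_boole, Finset.mem_univ, true_imp_iff, funext_iff]

theorem outer_update_smul (c : k) (a : (l : Fin d) → Fin (n l) → k) (l : Fin d) :
    outer (update a l (c • a l)) = c • outer a := by
  funext j
  rw [Pi.smul_apply, outer, outer, ← Finset.mul_prod_erase _ _ (Finset.mem_univ l),
    ← Finset.mul_prod_erase _ (fun i => a i (j i)) (Finset.mem_univ l), update_self, Pi.smul_apply,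
    smul_mul_assoc]
  congr 2
  exact Finset.prod_congr rfl fun i hi => by rw [update_of_ne (Finset.ne_of_mem_erase hi)]

variable (k n) in
/-- The Segre variety as a monoid under the Hadamard product. -/
def segreSubmonoid : Submonoid (Tensor k n) where
  carrier := segre k n
  one_mem' := ⟨1, outer_one⟩
  mul_mem' := by
    rintro _ _ ⟨a, rfl⟩ ⟨b, rfl⟩
    exact ⟨a * b, outer_mul a b⟩

theorem one_mem_segre : (1 : Tensor k n) ∈ segre k n :=
  (segreSubmonoid k n).one_mem

theorem mul_mem_segre {A B : Tensor k n} (hA : A ∈ segre k n) (hB : B ∈ segre k n) :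
    A * B ∈ segre k n :=
  (segreSubmonoid k n).mul_mem hA hB

theorem prod_mem_segre {ι : Type*} {s : Finset ι} {A : ι → Tensor k n}
    (hA : ∀ i ∈ s, A i ∈ segre k n) : ∏ i ∈ s, A i ∈ segre k n :=
  (segreSubmonoid k n).prod_mem hA

theorem inv_mem_segre {A : Tensor k n} (hA : A ∈ segre k n) : A⁻¹ ∈ segre k n := by
  obtain ⟨a, rfl⟩ := hA
  exact ⟨a⁻¹, outer_inv a⟩

theorem smul_mem_segre [NeZero d] (c : k) {A : Tensor k n} (hA : A ∈ segre k n) :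
    c • A ∈ segre k n := by
  obtain ⟨a, rfl⟩ := hA
  exact ⟨_, outer_update_smul c a 0⟩

theorem zero_mem_segre [NeZero d] : (0 : Tensor k n) ∈ segre k n := by
  simpa only [zero_smul] using smul_mem_segre 0 (one_mem_segre (k := k) (n := n))

theorem const_mem_segre [NeZero d] (c : k) : (const _ c : Tensor k n) ∈ segre k n := by
  convert smul_mem_segre c (one_mem_segre (k := k) (n := n)) using 1
  exact funext fun _ => (mul_one c).symm

theorem single_mem_segre [NeZero d] (j : Idx n) (c : k) :
    (Pi.single j c : Tensor k n) ∈ segre k n := by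
  simpa only [← Pi.single_smul, smul_eq_mul, mul_one] using
    smul_mem_segre c ⟨_, outer_single_one (k := k) j⟩

theorem apply_eq_mul_prod_of_swap {A : Tensor k n} {o : Idx n} (ho : A o ≠ 0)
    (hA : ∀ i j l, A (update i l (j l)) * A (update j l (i l)) = A i * A j) (j : Idx n) :
    A j = A o * ∏ l, A (update o l (j l)) / A o := by
  have apply_piecewise : ∀ s : Finset (Fin d),
      A (s.piecewise j o) = A o * ∏ l ∈ s, A (update o l (j l)) / A o := by
    intro s
    induction s using Finset.induction_on with
    | empty => rw [Finset.piecewise_empty, Finset.prod_empty, mul_one]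
    | insert a s ha ih =>
      have hswap := hA (s.piecewise j o) (update o a (j a)) a
      rw [update_self, update_idem, Finset.piecewise_eq_of_notMem _ _ _ ha, update_eq_self, ih]
        at hswap
      rw [Finset.prod_insert ha, Finset.piecewise_insert, eq_div_of_mul_eq ho hswap]
      ring
  simpa only [Finset.piecewise_univ] using apply_piecewise Finset.univ

theorem mem_segre_iff [NeZero d] {A : Tensor k n} :
    A ∈ segre k n ↔
      ∀ i j l, A (update i l (j l)) * A (update j l (i l)) = A i * A j := by
  refine ⟨?_, fun hA => ?_⟩
  · rintro ⟨a, rfl⟩ i j l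
    exact prod_update_mul_prod_update a i j l
  · obtain rfl | h0 := eq_or_ne A 0
    · exact zero_mem_segre
    obtain ⟨o, ho⟩ := Function.ne_iff.1 h0
    have eq_smul : A = A o • outer fun l x => A (update o l x) / A o :=
      funext (apply_eq_mul_prod_of_swap ho hA)
    rw [eq_smul]
    exact smul_mem_segre _ ⟨_, rfl⟩

theorem isNowhereZeroRankOne_of_mem_segre_of_isUnit [Nonempty (Idx n)] {D : Tensor k n}
    (hD : D ∈ segre k n) (h : IsUnit D) : IsNowhereZeroRankOne D :=
  ⟨⟨hD, h.ne_zero⟩, fun j => (Pi.isUnit_iff.1 h j).ne_zero⟩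

theorem IsNowhereZeroRankOne.isUnit {D : Tensor k n} (hD : IsNowhereZeroRankOne D) : IsUnit D :=
  Pi.isUnit_iff.2 fun j => (hD.2 j).isUnit

theorem IsNowhereZeroRankOne.mul {D E : Tensor k n} (hD : IsNowhereZeroRankOne D)
    (hE : IsNowhereZeroRankOne E) : IsNowhereZeroRankOne (D * E) := by
  obtain ⟨j, -⟩ := Function.ne_iff.1 hD.1.2
  have : Nonempty (Idx n) := ⟨j⟩
  exact isNowhereZeroRankOne_of_mem_segre_of_isUnit (mul_mem_segre hD.1.1 hE.1.1)
    (hD.isUnit.mul hE.isUnit)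

theorem IsNowhereZeroRankOne.inv {D : Tensor k n} (hD : IsNowhereZeroRankOne D) :
    IsNowhereZeroRankOne D⁻¹ := by
  obtain ⟨j, -⟩ := Function.ne_iff.1 hD.1.2
  have : Nonempty (Idx n) := ⟨j⟩
  exact isNowhereZeroRankOne_of_mem_segre_of_isUnit (inv_mem_segre hD.1.1) hD.isUnit.inv

theorem IsNowhereZeroRankOne.div {D E : Tensor k n} (hD : IsNowhereZeroRankOne D)
    (hE : IsNowhereZeroRankOne E) : IsNowhereZeroRankOne (D / E) := by
  rw [div_eq_mul_inv]
  exact hD.mul hE.inv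

end Segre

section Multisets

variable {α β γ : Type*}

theorem sum_filter_ne_zero [AddCommMonoid α] [DecidableEq α] (s : Multiset α) :
    (s.filter (· ≠ 0)).sum = s.sum := by
  have sum_filter_eq_zero : (s.filter fun a => ¬a ≠ 0).sum = 0 :=
    Multiset.sum_eq_zero fun a ha => not_not.1 (Multiset.mem_filter.1 ha).2
  rw [← Multiset.sum_filter_add_sum_filter_not (s := s) (· ≠ 0), sum_filter_eq_zero, add_zero]

theorem exists_map_univ_eq {r : ℕ} {s : Multiset α} (hs : s.card = r) :
    ∃ f : Fin r → α, Finset.univ.val.map f = s := by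
  obtain ⟨l, rfl⟩ := Quot.exists_rep s
  obtain rfl : l.length = r := hs
  exact ⟨l.get, by rw [Fin.univ_val_map, List.ofFn_get]; rfl⟩

theorem exists_equiv_of_map_univ_eq [Fintype α] [Fintype β] {f : α → γ} {g : β → γ}
    (h : Finset.univ.val.map f = Finset.univ.val.map g) : ∃ e : α ≃ β, ∀ a, f a = g (e a) := by
  classical
  have fiber_equiv : ∀ c, Nonempty ({a // f a = c} ≃ {b // g b = c}) := fun c => by
    have hcount := congrArg (Multiset.count c) h
    simp only [Multiset.count_map, eq_comm (a := c)] at hcount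
    exact ⟨Fintype.equivOfCardEq (by rw [Fintype.card_subtype, Fintype.card_subtype]; exact hcount)⟩
  exact ⟨Equiv.ofFiberEquiv fun c => (fiber_equiv c).some,
    fun a => (Equiv.ofFiberEquiv_map _ a).symm⟩

end Multisets

section Rank

variable {k : Type*} [Field k] {d : ℕ} {n : Fin d → ℕ}

theorem filter_ne_zero_mem_cpds [DecidableEq (Tensor k n)] {s : Multiset (Tensor k n)}
    (hs : ∀ A ∈ s, A ∈ segre k n) :
    s.filter (· ≠ 0) ∈ cpds (s.filter (· ≠ 0)).card s.sum :=
  ⟨rfl, fun A hA => ⟨hs A (Multiset.mem_of_mem_filter hA), (Multiset.mem_filter.1 hA).2⟩,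
    sum_filter_ne_zero s⟩

theorem tensorRank_sum_le_card_filter [DecidableEq (Tensor k n)] {s : Multiset (Tensor k n)}
    (hs : ∀ A ∈ s, A ∈ segre k n) : tensorRank s.sum ≤ (s.filter (· ≠ 0)).card :=
  Nat.sInf_le ⟨_, filter_ne_zero_mem_cpds hs⟩

theorem tensorRank_sum_le_card {s : Multiset (Tensor k n)} (hs : ∀ A ∈ s, A ∈ segre k n) :
    tensorRank s.sum ≤ s.card := by
  classical
  exact (tensorRank_sum_le_card_filter hs).trans (Multiset.card_le_card (Multiset.filter_le _ _))

theorem mem_cpds_tensorRank_of_card_le {s : Multiset (Tensor k n)} (hs : ∀ A ∈ s, A ∈ segre k n)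
    (hcard : s.card ≤ tensorRank s.sum) : s ∈ cpds (tensorRank s.sum) s.sum := by
  classical
  have filter_eq : s.filter (· ≠ 0) = s := Multiset.eq_of_le_of_card_le (Multiset.filter_le _ _)
    (hcard.trans (tensorRank_sum_le_card_filter hs))
  have hmem := filter_ne_zero_mem_cpds hs
  rwa [filter_eq, hcard.antisymm (tensorRank_sum_le_card hs)] at hmem

theorem cpds_tensorRank_nonempty [NeZero d] (T : Tensor k n) :
    (cpds (tensorRank T) T).Nonempty := by
  classical
  have hmem := filter_ne_zero_mem_cpds (s := Finset.univ.val.map fun j => Pi.single j (T j))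
    (Multiset.forall_mem_map_iff.2 fun j _ => single_mem_segre j (T j))
  rw [show Multiset.sum _ = T from Finset.univ_sum_single T] at hmem
  exact Nat.sInf_mem (s := {r | (cpds r T).Nonempty}) ⟨_, _, hmem⟩

theorem tensorRank_le_iff [NeZero d] {r : ℕ} {T : Tensor k n} :
    tensorRank T ≤ r ↔ ∃ A : Fin r → Tensor k n, (∀ t, A t ∈ segre k n) ∧ ∑ t, A t = T := by
  constructor
  · intro h
    obtain ⟨s, hcard, hs, rfl⟩ := cpds_tensorRank_nonempty T
    obtain ⟨A, hA⟩ := exists_map_univ_eq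
      (s := s + Multiset.replicate (r - s.card) 0) (r := r)
      (by rw [Multiset.card_add, Multiset.card_replicate]; omega)
    refine ⟨A, fun t => ?_, ?_⟩
    · have hmem := Multiset.mem_map_of_mem A (Finset.mem_univ_val t)
      rw [hA, Multiset.mem_add] at hmem
      obtain hmem | hmem := hmem
      · exact (hs _ hmem).1
      · rw [Multiset.eq_of_mem_replicate hmem]
        exact zero_mem_segre
    · rw [Finset.sum_eq_multiset_sum, hA, Multiset.sum_add, Multiset.sum_replicate, smul_zero,
        add_zero]
  · rintro ⟨A, hA, rfl⟩
    have hle := tensorRank_sum_le_card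
      (Multiset.forall_mem_map_iff (s := Finset.univ.val).2 fun t _ => hA t)
    rwa [Multiset.card_map, Finset.card_val, Finset.card_fin] at hle

end Rank

section Identifiability

variable {k : Type*} [Field k] {d : ℕ} {n : Fin d → ℕ} {m : ℕ} {r : Fin m → ℕ}

/-- Two HHDs that differ by permuting Hadamard factors of equal length and by scaling; this is the
relation in the definition of `essentialClass`. -/
def AreEquivalent (r : Fin m → ℕ) (H H' : Fin m → Multiset (Tensor k n)) : Prop :=
  ∃ (ψ : Equiv.Perm (Fin m)) (D : Fin m → Tensor k n),
    (∀ i, r (ψ i) = r i) ∧ (∀ i, IsNowhereZeroRankOne (D i)) ∧ ∏ i, D i = 1 ∧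
    ∀ i, H' (ψ i) = (H i).map (fun A => D i * A)

theorem AreEquivalent.symm {H H' : Fin m → Multiset (Tensor k n)} (h : AreEquivalent r H H') :
    AreEquivalent r H' H := by
  obtain ⟨ψ, D, hr, hD, hprod, hmap⟩ := h
  refine ⟨ψ.symm, fun i => (D (ψ.symm i))⁻¹, fun i => ?_, fun i => (hD _).inv, ?_, fun i => ?_⟩
  · rw [← hr, ψ.apply_symm_apply]
  · rw [Equiv.prod_comp ψ.symm fun i => (D i)⁻¹, Finset.prod_inv_distrib, hprod, inv_one]
  · obtain ⟨i, rfl⟩ := ψ.surjective i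
    simp only [ψ.symm_apply_apply, hmap, Multiset.map_map, Function.comp_def, ← mul_assoc,
      (hD i).isUnit.inv_mul_cancel, one_mul, Multiset.map_id']

theorem AreEquivalent.trans {H H' H'' : Fin m → Multiset (Tensor k n)}
    (h : AreEquivalent r H H') (h' : AreEquivalent r H' H'') : AreEquivalent r H H'' := by
  obtain ⟨ψ, D, hr, hD, hprod, hmap⟩ := h
  obtain ⟨ψ', D', hr', hD', hprod', hmap'⟩ := h'
  refine ⟨ψ.trans ψ', fun i => D' (ψ i) * D i, fun i => (hr' _).trans (hr i),
    fun i => (hD' _).mul (hD i), ?_, fun i => ?_⟩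
  · rw [Finset.prod_mul_distrib, Equiv.prod_comp ψ D', hprod, hprod', one_mul]
  · simp only [Equiv.trans_apply, hmap', hmap, Multiset.map_map, Function.comp_def, mul_assoc]

theorem isHHDIdentifiable_of_forall_areEquivalent {T : Tensor k n}
    {H : Fin m → Multiset (Tensor k n)} (hH : H ∈ hhds r T)
    (h : ∀ H' ∈ hhds r T, AreEquivalent r H H') : IsHHDIdentifiable r T := by
  have essentialClass_eq : ∀ H' ∈ hhds r T, essentialClass r T H' = hhds r T := fun H' hH' =>
    Set.Subset.antisymm (Set.sep_subset _ _) fun H'' hH'' =>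
      ⟨hH'', (h H' hH').symm.trans (h H'' hH'')⟩
  refine ⟨hhds r T, Set.eq_singleton_iff_unique_mem.2 ⟨⟨H, hH, essentialClass_eq H hH⟩, ?_⟩⟩
  rintro _ ⟨H', hH', rfl⟩
  exact essentialClass_eq H' hH'

/-- The HHD with Hadamard factors `∑ t, A i t`, forgetting the order of the summands. -/
def unorderedHHD (A : ∀ i, Fin (r i) → Tensor k n) : Fin m → Multiset (Tensor k n) :=
  fun i => Finset.univ.val.map (A i)

theorem unorderedHHD_mem_hhds {A : ∀ i, Fin (r i) → Tensor k n} (hA : ∀ i t, IsRankOne (A i t)) :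
    unorderedHHD A ∈ hhds r (∏ i, ∑ t, A i t) :=
  ⟨fun i => ⟨by rw [unorderedHHD, Multiset.card_map, Finset.card_val, Finset.card_fin],
    Multiset.forall_mem_map_iff.2 fun t _ => hA i t⟩, rfl⟩

theorem exists_unorderedHHD_eq {T : Tensor k n} {H : Fin m → Multiset (Tensor k n)}
    (hH : H ∈ hhds r T) :
    ∃ B : ∀ i, Fin (r i) → Tensor k n,
      unorderedHHD B = H ∧ (∀ i t, IsRankOne (B i t)) ∧ T = ∏ i, ∑ t, B i t := by
  obtain ⟨hH, rfl⟩ := hH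
  choose B hB using fun i => exists_map_univ_eq (hH i).1
  obtain rfl : unorderedHHD B = H := funext hB
  exact ⟨B, rfl, fun i t => (hH i).2 _ (Multiset.mem_map_of_mem _ (Finset.mem_univ_val t)), rfl⟩

theorem map_prod_mem_cpds {A : ∀ i, Fin (r i) → Tensor k n} (hA : ∀ i t, A i t ∈ segre k n)
    (hrank : tensorRank (∏ i, ∑ t, A i t) = ∏ i, r i) :
    Finset.univ.val.map (fun p : ∀ i, Fin (r i) => ∏ i, A i (p i)) ∈
      cpds (∏ i, r i) (∏ i, ∑ t, A i t) := by
  rw [← hrank, Fintype.prod_sum]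
  refine mem_cpds_tensorRank_of_card_le
    (Multiset.forall_mem_map_iff.2 fun p _ => prod_mem_segre fun i _ => hA i (p i)) ?_
  rw [← Finset.sum_eq_multiset_sum, ← Fintype.prod_sum, hrank]
  simp only [Multiset.card_map, Finset.card_val, Finset.card_univ, Fintype.card_pi,
    Fintype.card_fin, le_refl]

theorem exists_perm_of_isIdentifiable {A B : ∀ i, Fin (r i) → Tensor k n}
    (hA : ∀ i t, A i t ∈ segre k n) (hB : ∀ i t, B i t ∈ segre k n)
    (hAB : ∏ i, ∑ t, A i t = ∏ i, ∑ t, B i t)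
    (hid : IsIdentifiable (∏ i, r i) (∏ i, ∑ t, A i t)) :
    ∃ φ : Equiv.Perm (∀ i, Fin (r i)), ∀ p, ∏ i, B i (p i) = ∏ i, A i (φ p i) := by
  obtain ⟨hrank, s, hs⟩ := hid
  have hA_mem := map_prod_mem_cpds hA hrank
  have hB_mem := map_prod_mem_cpds hB (hAB ▸ hrank)
  rw [← hAB, hs, Set.mem_singleton_iff] at hB_mem
  rw [hs, Set.mem_singleton_iff] at hA_mem
  exact exists_equiv_of_map_univ_eq (hB_mem.trans hA_mem.symm)

theorem IsRelationFree.areEquivalent {A B : ∀ i, Fin (r i) → Tensor k n} (hfree : IsRelationFree A)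
    (hr : ∀ i, 2 ≤ r i) (hA : ∀ i t, IsNowhereZeroRankOne (A i t))
    (hB : ∀ i t, IsRankOne (B i t)) (φ : Equiv.Perm (∀ i, Fin (r i)))
    (hφ : ∀ p, ∏ i, B i (p i) = ∏ i, A i (φ p i)) :
    AreEquivalent r (unorderedHHD A) (unorderedHHD B) := by
  have : ∀ i, Nontrivial (Fin (r i)) := fun i => Fin.nontrivial_iff_two_le.2 (hr i)
  have isUnit_prod : ∀ p : ∀ i, Fin (r i), IsUnit (∏ i, A i (p i)) := fun p =>
    IsUnit.prod_univ_iff.2 fun i => (hA i (p i)).isUnit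
  have hB : ∀ i t, IsNowhereZeroRankOne (B i t) := fun i t =>
    have isUnit := isUnit_apply_of_forall_isUnit_prod (fun p => hφ p ▸ isUnit_prod (φ p)) i t
    ⟨hB i t, fun j => (Pi.isUnit_iff.1 isUnit j).ne_zero⟩
  obtain ⟨τ, g, hg⟩ := hfree.exists_axes_perm φ hφ
  let o : ∀ i, Fin (r (τ i)) := fun i => Classical.arbitrary _
  refine ⟨τ, fun i => B (τ i) (o i) / A i (g i (o i)),
    fun i => by simpa only [Fintype.card_fin] using Fintype.card_congr (g i),
    fun i => (hB _ _).div (hA _ _), ?_, fun i => ?_⟩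
  · rw [Finset.prod_div_distrib, hg, (isUnit_prod _).div_self]
  · have scale : ∀ t, B (τ i) t = B (τ i) (o i) / A i (g i (o i)) * A i (g i t) :=
      eq_div_mul_of_prod_eq (fun i t => (hA i (g i t)).isUnit) hg o i
    simp only [unorderedHHD, Multiset.map_map, Function.comp_def,
      ← Multiset.map_univ_val_equiv (g i), ← scale]

theorem IsRelationFree.isHHDIdentifiable {A : ∀ i, Fin (r i) → Tensor k n}
    (hfree : IsRelationFree A) (hr : ∀ i, 2 ≤ r i) (hA : ∀ i t, IsNowhereZeroRankOne (A i t))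
    (hid : IsIdentifiable (∏ i, r i) (∏ i, ∑ t, A i t)) :
    IsHHDIdentifiable r (∏ i, ∑ t, A i t) := by
  refine isHHDIdentifiable_of_forall_areEquivalent
    (unorderedHHD_mem_hhds fun i t => (hA i t).1) fun H hH => ?_
  obtain ⟨B, rfl, hB, hAB⟩ := exists_unorderedHHD_eq hH
  obtain ⟨φ, hφ⟩ := exists_perm_of_isIdentifiable (fun i t => (hA i t).1.1)
    (fun i t => (hB i t).1) hAB hid
  exact hfree.areEquivalent hr hA hB φ hφ

end Identifiability

section ZariskiTopology

open MvPolynomial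

variable {k : Type*} [Field k] {ι κ : Type*}

theorem isZariskiClosed_setOf_forall_mem (S : Set (MvPolynomial ι k)) :
    IsZariskiClosed {x : ι → k | ∀ f ∈ S, aeval x f = 0} :=
  ⟨Ideal.span S, (zeroLocus_span S).symm⟩

theorem IsZariskiClosed.iInter {V : κ → Set (ι → k)} (hV : ∀ c, IsZariskiClosed (V c)) :
    IsZariskiClosed (⋂ c, V c) := by
  choose I hI using hV
  obtain rfl : V = fun c => zeroLocus k (I c) := funext hI
  exact ⟨⨆ c, I c, zeroLocus_vanishingIdeal_galoisConnection.l_iSup.symm⟩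

theorem IsZariskiClosed.inter {V W : Set (ι → k)} (hV : IsZariskiClosed V)
    (hW : IsZariskiClosed W) : IsZariskiClosed (V ∩ W) := by
  rw [Set.inter_eq_iInter]
  exact .iInter (Bool.rec hW hV)

theorem IsZariskiClosed.preimage_comp {V : Set (ι → k)} (hV : IsZariskiClosed V) (e : ι → κ) :
    IsZariskiClosed {x : κ → k | x ∘ e ∈ V} := by
  obtain ⟨I, rfl⟩ := hV
  convert isZariskiClosed_setOf_forall_mem (rename e '' (I : Set (MvPolynomial ι k))) using 1
  simp only [mem_zeroLocus_iff, Set.forall_mem_image, SetLike.mem_coe, aeval_rename]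

theorem isZariskiClosed_zariskiClosure (V : Set (ι → k)) : IsZariskiClosed (zariskiClosure V) :=
  ⟨_, rfl⟩

theorem subset_zariskiClosure (V : Set (ι → k)) : V ⊆ zariskiClosure V :=
  zeroLocus_vanishingIdeal_le V

theorem generically_of_aeval_ne_zero {V : Set (ι → k)} {P : (ι → k) → Prop}
    (hV : IsZariskiClosed V) {f : MvPolynomial ι k} (hf : ∃ x ∈ V, aeval x f ≠ 0)
    (h : ∀ x ∈ V, aeval x f ≠ 0 → P x) : Generically V P := by
  obtain ⟨x, hx, hfx⟩ := hf
  refine ⟨V ∩ {x | ∀ g ∈ ({f} : Set _), aeval x g = 0},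
    hV.inter (isZariskiClosed_setOf_forall_mem {f}), ⟨Set.inter_subset_left, fun hsub => ?_⟩,
    fun x hx => h x hx.1 fun hfx => hx.2 ⟨hx.1, fun g hg => by rwa [Set.mem_singleton_iff.1 hg]⟩⟩
  exact hfx ((hsub hx).2 f rfl)

variable {d : ℕ} {n : Fin d → ℕ} {m : ℕ} {r : Fin m → ℕ}

theorem isZariskiClosed_segre [NeZero d] : IsZariskiClosed (segre k n) := by
  convert isZariskiClosed_setOf_forall_mem (k := k) <| Set.range fun c : Idx n × Idx n × Fin d =>
    X (Function.update c.1 c.2.2 (c.2.1 c.2.2)) * X (Function.update c.2.1 c.2.2 (c.1 c.2.2)) -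
      X c.1 * X c.2.1 using 1
  ext A
  simp only [mem_segre_iff, Set.mem_ofPred_eq, Set.forall_mem_range, Prod.forall, map_sub, map_mul,
    aeval_X, sub_eq_zero]

theorem isZariskiClosed_orderedHHDs [NeZero d] : IsZariskiClosed (orderedHHDs k n r) := by
  rw [orderedHHDs, Set.ofPred_forall]
  exact .iInter fun p => isZariskiClosed_segre.preimage_comp (Prod.mk p)

end ZariskiTopology

section PolynomialMaps

open MvPolynomial

variable {ι κ : Type*}

theorem exists_aeval_ne_zero {R : Type*} [CommRing R] [IsDomain R] [Infinite R]
    {f : MvPolynomial ι R} (hf : f ≠ 0) : ∃ x : ι → R, aeval x f ≠ 0 := by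
  by_contra! h
  exact hf (MvPolynomial.funext fun x => by simpa only [map_zero, aeval_eq_eval] using h x)

theorem finitePresentation_toRingHom {R A B : Type*} [CommRing R] [CommRing A] [CommRing B]
    [Algebra R A] [Algebra R B] [IsNoetherianRing A] [Algebra.FiniteType R B] (f : A →ₐ[R] B) :
    f.toRingHom.FinitePresentation := by
  refine RingHom.FinitePresentation.of_finiteType.1
    (RingHom.FiniteType.of_comp_finiteType (f := algebraMap R A) ?_)
  rw [AlgHom.toRingHom_eq_coe, f.comp_algebraMap, RingHom.finiteType_algebraMap]
  infer_instance

theorem exists_forall_le_mem_of_isConstructible {R : Type*} [CommRing R]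
    {s : Set (PrimeSpectrum R)} (hs : Topology.IsConstructible s) {x : PrimeSpectrum R}
    (hx : x ∈ s) : ∃ f ∉ x.asIdeal, ∀ y, x ≤ y → f ∉ y.asIdeal → y ∈ s := by
  obtain ⟨S, rfl⟩ := PrimeSpectrum.exists_constructibleSetData_iff.2 hs
  obtain ⟨C, hC, hxg, hxf⟩ := Set.mem_iUnion₂.1 hx
  simp only [PrimeSpectrum.mem_zeroLocus, Set.singleton_subset_iff, SetLike.mem_coe] at hxf
  refine ⟨C.f, hxf, fun y hxy hyf => Set.mem_iUnion₂.2 ⟨C, hC, Set.Subset.trans hxg hxy, ?_⟩⟩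
  simpa only [PrimeSpectrum.mem_zeroLocus, Set.singleton_subset_iff, SetLike.mem_coe] using hyf

variable {k : Type*} [Field k]

/-- The polynomial map `k^ι → k^κ` with components `θ`. -/
noncomputable def polyMap (θ : κ → MvPolynomial ι k) (x : ι → k) : κ → k :=
  fun c => aeval x (θ c)

theorem aeval_polyMap (θ : κ → MvPolynomial ι k) (x : ι → k) (f : MvPolynomial κ k) :
    aeval (polyMap θ x) f = aeval x (bind₁ θ f) :=
  (aeval_bind₁ x θ f).symm

theorem vanishingIdeal_range_polyMap [Infinite k] (θ : κ → MvPolynomial ι k) :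
    vanishingIdeal k (Set.range (polyMap θ)) = RingHom.ker (bind₁ θ) := by
  ext f
  simp only [mem_vanishingIdeal_iff, Set.forall_mem_range, RingHom.mem_ker, aeval_polyMap]
  refine ⟨fun h => ?_, fun h x => by rw [h, map_zero]⟩
  by_contra hf
  obtain ⟨x, hx⟩ := exists_aeval_ne_zero hf
  exact hx (h x)

theorem polyMap_eq_of_comap_bind₁_eq_pointToPoint {θ : κ → MvPolynomial ι k}
    {q : PrimeSpectrum (MvPolynomial ι k)} {y : κ → k}
    (hq : PrimeSpectrum.comap (bind₁ θ).toRingHom q = pointToPoint y) {x : ι → k}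
    (hx : x ∈ zeroLocus k q.asIdeal) : polyMap θ x = y := by
  funext c
  have hmem : X c - C (y c) ∈ (PrimeSpectrum.comap (bind₁ θ).toRingHom q).asIdeal := by
    rw [hq]
    refine (mem_vanishingIdeal_singleton_iff _ _).2 ?_
    rw [map_sub, aeval_X, aeval_C, Algebra.algebraMap_self_apply, sub_self]
  have haeval := hx _ hmem
  rwa [AlgHom.toRingHom_eq_coe, RingHom.coe_coe, map_sub, map_sub, bind₁_X_right, bind₁_C_right,
    aeval_C, sub_eq_zero] at haeval

theorem exists_mem_zeroLocus_aeval_ne_zero [IsAlgClosed k] [Finite ι]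
    {q : PrimeSpectrum (MvPolynomial ι k)} {g : MvPolynomial ι k} (hg : g ∉ q.asIdeal) :
    ∃ x ∈ zeroLocus k q.asIdeal, aeval x g ≠ 0 := by
  rw [← IsPrime.vanishingIdeal_zeroLocus (K := k) q.asIdeal, mem_vanishingIdeal_iff] at hg
  push Not at hg
  exact hg

theorem exists_subset_image_polyMap [IsAlgClosed k] [Finite ι] [Finite κ]
    (θ : κ → MvPolynomial ι k) {g : MvPolynomial ι k} (hg : g ≠ 0) :
    ∃ f : MvPolynomial κ k, bind₁ θ f ≠ 0 ∧
      ∀ y ∈ zariskiClosure (Set.range (polyMap θ)), aeval y f ≠ 0 →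
        ∃ x, aeval x g ≠ 0 ∧ polyMap θ x = y := by
  have : Infinite k := IsAlgClosed.instInfinite
  have constructible := PrimeSpectrum.isConstructible_comap_image
    (finitePresentation_toRingHom (bind₁ θ)) (PrimeSpectrum.isConstructible_basicOpen (f := g))
  obtain ⟨f, hf, hmem⟩ := exists_forall_le_mem_of_isConstructible constructible
    (Set.mem_image_of_mem _ (show (⊥ : PrimeSpectrum _) ∈ PrimeSpectrum.basicOpen g from hg))
  refine ⟨f, hf, fun y hy hfy => ?_⟩
  rw [zariskiClosure, vanishingIdeal_range_polyMap] at hy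
  obtain ⟨q, hgq, hq⟩ := hmem (pointToPoint y)
    (fun a ha => (mem_vanishingIdeal_singleton_iff y a).2 (hy a ha))
    (fun hfy' => hfy ((mem_vanishingIdeal_singleton_iff y f).1 hfy'))
  obtain ⟨x, hx, hgx⟩ := exists_mem_zeroLocus_aeval_ne_zero hgq
  exact ⟨x, hgx, polyMap_eq_of_comap_bind₁_eq_pointToPoint hq hx⟩

theorem generically_zariskiClosure_range_polyMap [IsAlgClosed k] [Finite ι] [Finite κ]
    {θ : κ → MvPolynomial ι k} {P : (κ → k) → Prop} {g : MvPolynomial ι k} (hg : g ≠ 0)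
    (h : ∀ x, aeval x g ≠ 0 → P (polyMap θ x)) :
    Generically (zariskiClosure (Set.range (polyMap θ))) P := by
  have : Infinite k := IsAlgClosed.instInfinite
  obtain ⟨f, hf, himage⟩ := exists_subset_image_polyMap θ hg
  obtain ⟨x, hx⟩ := exists_aeval_ne_zero hf
  rw [← aeval_polyMap] at hx
  refine generically_of_aeval_ne_zero (isZariskiClosed_zariskiClosure _)
    ⟨polyMap θ x, subset_zariskiClosure _ ⟨x, rfl⟩, hx⟩ fun y hy hfy => ?_
  obtain ⟨x, hgx, rfl⟩ := himage y hy hfy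
  exact h x hgx

end PolynomialMaps

section RelationFreePolynomials

open MvPolynomial

variable {ι : Type*} [Fintype ι] {X : ι → Type*}

theorem prod_X_eq_monomial {R : Type*} [CommSemiring R] (p : ∀ i, X i) :
    (∏ i, MvPolynomial.X ⟨i, p i⟩ : MvPolynomial (Σ i, X i) R) =
      monomial (∑ i, Finsupp.single ⟨i, p i⟩ 1) 1 :=
  (monomial_sum_one _ _).symm

theorem sum_single_sigma_apply [∀ i, DecidableEq (X i)] (p : ∀ i, X i) (i : ι) (t : X i) :
    (∑ i, Finsupp.single (⟨i, p i⟩ : Σ i, X i) 1) ⟨i, t⟩ = if p i = t then 1 else 0 := by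
  classical
  rw [Finsupp.finsetSum_apply, Finset.sum_eq_single i]
  · simp only [Finsupp.single_apply, Sigma.mk.injEq, heq_eq_eq, true_and]
  · rintro j - hji
    exact Finsupp.single_eq_of_ne fun h => hji (congrArg Sigma.fst h).symm
  · exact fun h => absurd (Finset.mem_univ i) h

theorem isRelationFree_X {R : Type*} [CommSemiring R] [Nontrivial R] :
    IsRelationFree fun i t => (MvPolynomial.X ⟨i, t⟩ : MvPolynomial (Σ i, X i) R) := by
  classical
  intro p q p' q' h i
  simp only [prod_X_eq_monomial, monomial_mul, one_mul] at h
  have exponents_eq := monomial_left_injective one_ne_zero h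
  have count_eq : ∀ t : X i, ((if p i = t then 1 else 0) + if q i = t then 1 else 0) =
      (if p' i = t then 1 else 0) + if q' i = t then 1 else 0 := fun t => by
    simpa only [Finsupp.add_apply, sum_single_sigma_apply] using
      DFunLike.congr_fun exponents_eq ⟨i, t⟩
  have count_p := count_eq (p i)
  have count_q := count_eq (q i)
  rw [Sym2.eq_iff]
  grind

theorem exists_ne_zero_forall_isRelationFree {R : Type*} [CommRing R] [IsDomain R]
    [∀ i, Finite (X i)] :
    ∃ f : MvPolynomial (Σ i, X i) R, f ≠ 0 ∧
      ∀ z : (Σ i, X i) → R, aeval z f ≠ 0 → IsRelationFree fun i t => z ⟨i, t⟩ := by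
  classical
  cases nonempty_fintype (∀ i, X i)
  let G := ∀ i, X i
  let M : G → MvPolynomial (Σ i, X i) R := fun p => ∏ i, MvPolynomial.X ⟨i, p i⟩
  let relation : G × G × G × G → MvPolynomial (Σ i, X i) R := fun w =>
    M w.1 * M w.2.1 - M w.2.2.1 * M w.2.2.2
  refine ⟨∏ w with relation w ≠ 0, relation w,
    Finset.prod_ne_zero_iff.2 fun w hw => (Finset.mem_filter.1 hw).2, fun z hz p q p' q' h => ?_⟩
  refine isRelationFree_X (R := R) p q p' q' (sub_eq_zero.1 ?_)
  by_contra hne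
  rw [map_prod] at hz
  refine Finset.prod_ne_zero_iff.1 hz (p, q, p', q')
    (Finset.mem_filter.2 ⟨Finset.mem_univ _, hne⟩) ?_
  simpa only [relation, M, map_sub, map_mul, map_prod, aeval_X, sub_eq_zero] using h

end RelationFreePolynomials

section GenericHHDs

open MvPolynomial

variable {k : Type*} [Field k] {d : ℕ} {n : Fin d → ℕ} {m : ℕ} {r : Fin m → ℕ}

theorem exists_aeval_ne_zero_forall_isRelationFree [Infinite k] [NeZero d] [Nonempty (Idx n)] :
    ∃ f : MvPolynomial (OrderedIdx n r) k, (∃ x ∈ orderedHHDs k n r, aeval x f ≠ 0) ∧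
      ∀ x : OrderedIdx n r → k, aeval x f ≠ 0 →
        (∀ c, x c ≠ 0) ∧ IsRelationFree fun i t (j : Idx n) => x (⟨i, t⟩, j) := by
  obtain ⟨f, hf, hfree⟩ := exists_ne_zero_forall_isRelationFree (R := k) (X := fun i => Fin (r i))
  let j₀ : Idx n := Classical.arbitrary _
  refine ⟨(∏ c, X c) * rename (·, j₀) f, ?_, fun x hx => ?_⟩
  · have hne : (∏ c : OrderedIdx n r, X c.1) * f ≠ 0 :=
      mul_ne_zero (Finset.prod_ne_zero_iff.2 fun c _ => X_ne_zero _) hf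
    obtain ⟨z, hz⟩ := exists_aeval_ne_zero hne
    refine ⟨fun c => z c.1, fun p => const_mem_segre (z p), ?_⟩
    simpa only [map_mul, map_prod, aeval_X, aeval_rename, Function.comp_def] using hz
  · rw [map_mul, map_prod, aeval_rename] at hx
    refine ⟨fun c => ?_, (hfree _ (right_ne_zero_of_mul hx)).of_map (Pi.evalMonoidHom _ j₀)⟩
    simpa only [aeval_X] using Finset.prod_ne_zero_iff.1 (left_ne_zero_of_mul hx) c
      (Finset.mem_univ c)

theorem exists_aeval_ne_zero_forall_isHHDIdentifiable [Infinite k] [NeZero d] [Nonempty (Idx n)]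
    (hr : ∀ i, 2 ≤ r i) :
    ∃ f : MvPolynomial (OrderedIdx n r) k, (∃ x ∈ orderedHHDs k n r, aeval x f ≠ 0) ∧
      ∀ x ∈ orderedHHDs k n r, aeval x f ≠ 0 →
        IsIdentifiable (∏ i, r i) (hhdTensor r x) → IsHHDIdentifiable r (hhdTensor r x) := by
  obtain ⟨f, hf, hfree⟩ := exists_aeval_ne_zero_forall_isRelationFree (k := k) (n := n) (r := r)
  refine ⟨f, hf, fun x hx hfx => ?_⟩
  obtain ⟨hne, hfree⟩ := hfree x hfx
  refine hfree.isHHDIdentifiable hr fun i t => ?_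
  exact isNowhereZeroRankOne_of_mem_segre_of_isUnit (hx ⟨i, t⟩)
    (Pi.isUnit_iff.2 fun j => (hne _).isUnit)

/-- Coordinates of the vectors whose tensor products are the summands of an ordered HHD. -/
abbrev FactorIdx {d m : ℕ} (n : Fin d → ℕ) (r : Fin m → ℕ) : Type :=
  ((i : Fin m) × Fin (r i)) × ((l : Fin d) × Fin (n l))

variable (k) in
/-- The entries of the summands of an ordered HHD as polynomials in the entries of the vectors. -/
noncomputable def summandPoly (n : Fin d → ℕ) (r : Fin m → ℕ) (c : OrderedIdx n r) :
    MvPolynomial (FactorIdx n r) k :=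
  ∏ l, X (c.1, ⟨l, c.2 l⟩)

variable (k) in
/-- The entries of the tensor of an ordered HHD as polynomials in the entries of the vectors. -/
noncomputable def hhdPoly (n : Fin d → ℕ) (r : Fin m → ℕ) (j : Idx n) :
    MvPolynomial (FactorIdx n r) k :=
  ∏ i, ∑ t : Fin (r i), summandPoly k n r (⟨i, t⟩, j)

theorem polyMap_summandPoly (y : FactorIdx n r → k) (c : OrderedIdx n r) :
    polyMap (summandPoly k n r) y c = outer (fun l x => y (c.1, ⟨l, x⟩)) c.2 := by
  simp only [polyMap, summandPoly, outer, map_prod, aeval_X]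

theorem polyMap_hhdPoly (y : FactorIdx n r → k) :
    polyMap (hhdPoly k n r) y = hhdTensor r (polyMap (summandPoly k n r) y) := by
  funext j
  simp only [polyMap, hhdPoly, hhdTensor, map_prod, map_sum, Finset.prod_apply, Finset.sum_apply]

theorem range_polyMap_summandPoly :
    Set.range (polyMap (summandPoly k n r)) = orderedHHDs k n r := by
  ext x
  constructor
  · rintro ⟨y, rfl⟩ p
    exact ⟨fun l t => y (p, ⟨l, t⟩), funext fun j => (polyMap_summandPoly y (p, j)).symm⟩
  · intro hx
    choose a ha using hx
    exact ⟨fun c => a c.1 c.2.1 c.2.2,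
      funext fun c => (polyMap_summandPoly _ c).trans (congrFun (ha c.1) c.2)⟩

theorem image_hhdTensor_orderedHHDs [NeZero d] :
    hhdTensor r '' orderedHHDs k n r = openHadamardSecant k n r := by
  ext T
  constructor
  · rintro ⟨x, hx, rfl⟩
    exact ⟨_, fun i => tensorRank_le_iff.2 ⟨_, fun t => hx ⟨i, t⟩, rfl⟩, rfl⟩
  · rintro ⟨Y, hY, rfl⟩
    choose A hA hsum using fun i => tensorRank_le_iff.1 (hY i)
    exact ⟨fun c => A c.1.1 c.1.2 c.2, fun p => hA p.1 p.2,
      Finset.prod_congr rfl fun i _ => hsum i⟩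

theorem range_polyMap_hhdPoly [NeZero d] :
    Set.range (polyMap (hhdPoly k n r)) = openHadamardSecant k n r := by
  rw [← image_hhdTensor_orderedHHDs, ← range_polyMap_summandPoly, ← Set.range_comp]
  exact congrArg Set.range (funext polyMap_hhdPoly)

theorem generically_hadamardSecant_of_aeval_ne_zero [IsAlgClosed k] [NeZero d]
    {P : Tensor k n → Prop} {f : MvPolynomial (OrderedIdx n r) k}
    (hf : ∃ x ∈ orderedHHDs k n r, aeval x f ≠ 0)
    (h : ∀ x ∈ orderedHHDs k n r, aeval x f ≠ 0 → P (hhdTensor r x)) :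
    Generically (hadamardSecant k n r) P := by
  rw [hadamardSecant, ← range_polyMap_hhdPoly]
  rw [← range_polyMap_summandPoly] at hf h
  obtain ⟨_, ⟨y, rfl⟩, hfy⟩ := hf
  rw [aeval_polyMap] at hfy
  refine generically_zariskiClosure_range_polyMap
    (ne_zero_of_map hfy) fun y hy => ?_
  rw [polyMap_hhdPoly]
  exact h _ ⟨y, rfl⟩ (by rwa [aeval_polyMap])

end GenericHHDs

end HHD

theorem mainTheorem1_general {k : Type*} [Field k] [Infinite k] {d m : ℕ} (hd : 0 < d)
    (n : Fin d → ℕ) (hn : ∀ l, 0 < n l) (r : Fin m → ℕ) (hr : ∀ i, 2 ≤ r i) :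
    HHD.Generically (HHD.orderedHHDs k n r) (fun x =>
      HHD.IsIdentifiable (∏ i, r i) (HHD.hhdTensor r x) →
        HHD.IsHHDIdentifiable r (HHD.hhdTensor r x)) ∧
    (IsAlgClosed k →
      HHD.Generically (HHD.hadamardSecant k n r) (fun T =>
        HHD.IsIdentifiable (∏ i, r i) T → HHD.IsHHDIdentifiable r T)) := by
  have : NeZero d := ⟨hd.ne'⟩
  have : Nonempty (HHD.Idx n) := ⟨fun l => ⟨0, hn l⟩⟩
  obtain ⟨f, hf, h⟩ := HHD.exists_aeval_ne_zero_forall_isHHDIdentifiable (k := k) (n := n) hr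
  exact ⟨HHD.generically_of_aeval_ne_zero HHD.isZariskiClosed_orderedHHDs hf h,
    fun _ => HHD.generically_hadamardSecant_of_aeval_ne_zero hf h⟩

theorem mainTheorem1 {k : Type*} [Field k] [CharZero k] {d m : ℕ} (hd : 0 < d)
    (n : Fin d → ℕ) (hn : ∀ l, 0 < n l) (r : Fin m → ℕ) (hr : ∀ i, 2 ≤ r i) :
    HHD.Generically (HHD.orderedHHDs k n r) (fun x =>
      HHD.IsIdentifiable (∏ i, r i) (HHD.hhdTensor r x) →
        HHD.IsHHDIdentifiable r (HHD.hhdTensor r x)) ∧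
    (IsAlgClosed k →
      HHD.Generically (HHD.hadamardSecant k n r) (fun T =>
        HHD.IsIdentifiable (∏ i, r i) T → HHD.IsHHDIdentifiable r T)) :=
  have : Infinite k := CharZero.infinite k
  mainTheorem1_general hd n hn r hr
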